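/- Let $W=P_{Y|X}$ be a channel (Markov kernel) from a nonempty measurable space $\mathcal X$ to a measurable space $\Omega$, and for $n\ge 1$ let $W^{\otimes n}$ be its memoryless extension, $W_{x^n}:=W_{x_1}\otimes\cdots\otimes W_{x_n}$. For real $\alpha\ge 1$ and $h\ge 0$ put $$c_\alpha(h):=\inf_{t>0}\left\{(\alpha-1)t+\frac{h}{1-e^{-t}}\right\}.$$ All logarithms are natural. (1) Let $Q_Y$ be a probability measure on $\Omega$ with $W_x\ll Q_Y$ for all $x\in\mathcal X$ and $$\alpha:=\sup_{x\in\mathcal X}\left\|\frac{dW_x}{dQ_Y}\right\|_{L^\infty(Q_Y)}<\infty .$$ Then $\alpha\ge 1$. Moreover, let $n\ge 1$ and let $I-Z^n-X^n-Y^n$ be a Markov chain of random variables, where $I$ takes values in a countable discrete set, $X^n$ in $\mathcal X^n$, $Y^n$ and $Z^n$ in $\Omega^n$, and $P_{Y^n|X^n}=P_{Z^n|X^n}=W^{\otimes n}$. If the conditional Shannon entropy $H(I|X^n)$ is finite, then so is $H(I|Y^n)$, and with $h:=\frac1n H(I|X^n)$, $$\frac1n H(I|Y^n)\le c_\alpha(h).$$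 (2) For $\alpha>1$ and $h>0$ the infimum defining $c_\alpha(h)$ is a minimum, and for $\alpha>1$ and $h\ge 0$ $$c_\alpha(h)=(\alpha-1)\left[\ln\left(1+\frac{h}{2(\alpha-1)}+\sqrt{\frac{h}{\alpha-1}+\frac{h^2}{4(\alpha-1)^2}}\right)+\frac{h}{2(\alpha-1)}+\sqrt{\frac{h}{\alpha-1}+\frac{h^2}{4(\alpha-1)^2}}\,\right].$$ For $\alpha=1$ and $h\ge 0$, $c_1(h)=h$. (3) Suppose $\Omega$ is countable and discrete. If $\mathcal X$ or $\Omega$ is finite, then $\sum_{y\in\Omega}\sup_{x\in\mathcal X}W_x(y)<\infty$. Whenever this sum is finite, there is a probability measure $Q_Y$ on $\Omega$ with $W_x\ll Q_Y$ for all $x$ and $$\sup_{x\in\mathcal X}\left\|\frac{dW_x}{dQ_Y}\right\|_{L^\infty(Q_Y)}=\sum_{y\in\Omega}\sup_{x\in\mathcal X}W_x(y).$$ -/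

import Mathlib

open MeasureTheory ProbabilityTheory Set
open scoped ENNReal

noncomputable section

namespace RelayChannel

/-- Measurability of `xⁿ ↦ W_{x₁} ⊗ ⋯ ⊗ W_{xₙ}`. -/
lemma measurable_pi_kernel {𝓧 Ω : Type*} [MeasurableSpace 𝓧] [MeasurableSpace Ω]
    (W : Kernel 𝓧 Ω) [IsMarkovKernel W] (n : ℕ) :
    Measurable (fun x : Fin n → 𝓧 => Measure.pi (fun i => W (x i))) := by
  refine Measurable.measure_of_isPiSystem_of_isProbabilityMeasure
    (S := Set.pi univ '' Set.pi univ fun _ : Fin n => {s : Set Ω | MeasurableSet s})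
    generateFrom_pi.symm isPiSystem_pi ?_
  rintro _ ⟨s, hs, rfl⟩
  simp only [Measure.pi_pi]
  refine Finset.measurable_prod _ fun i _ => ?_
  exact (W.measurable_coe (hs i (mem_univ i))).comp (measurable_pi_apply i)

/-- The memoryless extension `W^{⊗n}`: the input `xⁿ` is sent to `W_{x₁} ⊗ ⋯ ⊗ W_{xₙ}`. -/
def memoryless {𝓧 Ω : Type*} [MeasurableSpace 𝓧] [MeasurableSpace Ω]
    (W : Kernel 𝓧 Ω) [IsMarkovKernel W] (n : ℕ) : Kernel (Fin n → 𝓧) (Fin n → Ω) where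
  toFun x := Measure.pi (fun i => W (x i))
  measurable' := measurable_pi_kernel W n

instance {𝓧 Ω : Type*} [MeasurableSpace 𝓧] [MeasurableSpace Ω]
    (W : Kernel 𝓧 Ω) [IsMarkovKernel W] (n : ℕ) : IsMarkovKernel (memoryless W n) :=
  ⟨fun x => by
    change IsProbabilityMeasure (Measure.pi (fun i => W (x i)))
    infer_instance⟩

/-- `P_{B|A} = κ`: the joint law of `(A, B)` is the law of `A` followed by the channel `κ`. -/
def HasCondLaw {S 𝓐 𝓑 : Type*} [MeasurableSpace S] [MeasurableSpace 𝓐] [MeasurableSpace 𝓑]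
    (P : Measure S) (B : S → 𝓑) (A : S → 𝓐) (κ : Kernel 𝓐 𝓑) : Prop :=
  P.map (fun ω => (A ω, B ω)) = (P.map A) ⊗ₘ κ

/-- The Markov chain `A – B – C`: the conditional law of `A` given `(B, C)` is a Markov kernel
that depends on `B` only. -/
def IsMarkovTriple {S 𝓐 𝓑 𝓒 : Type*} [MeasurableSpace S] [MeasurableSpace 𝓐]
    [MeasurableSpace 𝓑] [MeasurableSpace 𝓒]
    (P : Measure S) (A : S → 𝓐) (B : S → 𝓑) (C : S → 𝓒) : Prop :=
  ∃ κ : Kernel 𝓑 𝓐, IsMarkovKernel κ ∧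
    HasCondLaw P A (fun ω => (B ω, C ω)) (κ.prodMkRight 𝓒)

/-- The Markov chain `A – B – C – D`, that is, `A – B – (C, D)` and `B – C – D`. -/
def IsMarkovQuadruple {S 𝓐 𝓑 𝓒 𝓓 : Type*} [MeasurableSpace S] [MeasurableSpace 𝓐]
    [MeasurableSpace 𝓑] [MeasurableSpace 𝓒] [MeasurableSpace 𝓓]
    (P : Measure S) (A : S → 𝓐) (B : S → 𝓑) (C : S → 𝓒) (D : S → 𝓓) : Prop :=
  IsMarkovTriple P A B (fun ω => (C ω, D ω)) ∧ IsMarkovTriple P B C D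

/-- Conditional Shannon entropy (in nats) `H(I|U) = 𝔼[∑ᵢ -p(i|U) ln p(i|U)]` of a discrete random
variable `I` given an arbitrary random variable `U`, where `p(·|u)` is the conditional law. -/
def condEntropy {S ι 𝓤 : Type*} [MeasurableSpace S] [MeasurableSpace ι] [MeasurableSpace 𝓤]
    [Countable ι] [DiscreteMeasurableSpace ι] [Nonempty ι]
    (P : Measure S) [IsFiniteMeasure P] (I : S → ι) (U : S → 𝓤) : ℝ≥0∞ :=
  ∫⁻ u, ∑' i : ι, ENNReal.ofReal (Real.negMulLog ((condDistrib I U P u).real {i})) ∂(P.map U)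

/-- `sup_x ‖dW_x/dQ‖_∞`, with the essential supremum taken with respect to `Q`
(used when every `W_x` is absolutely continuous with respect to `Q`). -/
def densityBound {𝓧 Ω : Type*} [MeasurableSpace 𝓧] [MeasurableSpace Ω]
    (W : Kernel 𝓧 Ω) (Q : Measure Ω) : ℝ≥0∞ :=
  ⨆ x, essSup ((W x).rnDeriv Q) Q

/-- The values `(α - 1) t + h / (1 - e^{-t})`, `t > 0`. -/
def boundValues (α h : ℝ) : Set ℝ :=
  (fun t : ℝ => (α - 1) * t + 1 / (1 - Real.exp (-t)) * h) '' Ioi 0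

/-- `c_α(h)`, the infimum over `t > 0` of `(α - 1) t + h / (1 - e^{-t})`. -/
def cBound (α h : ℝ) : ℝ := sInf (boundValues α h)

/-- The closed form of `c_α(h)` for `α > 1`. -/
def cClosed (α h : ℝ) : ℝ :=
  (α - 1) *
    (Real.log (1 + h / (2 * (α - 1)) + √(h / (α - 1) + h ^ 2 / (4 * (α - 1) ^ 2)))
      + h / (2 * (α - 1)) + √(h / (α - 1) + h ^ 2 / (4 * (α - 1) ^ 2)))

end RelayChannel

end

/-! The entropy bound rests on reverse hypercontractivity. Fix `p = 1 - e^{-t}` and an input `xⁿ`,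
and let `T` be the product over the coordinates of the averaging operators `(1 - p) id + p W_{x_j}`.
For `0 ≤ f ≤ 1` and `μ = W_{x₁} ⊗ ⋯ ⊗ W_{xₙ}` one has `exp 𝔼_μ ln (T f) ≥ (𝔼_μ f^p)^{1/p}`. For one
letter this is a scalar inequality integrated against `μ` (`lintegral_negLog_average_le`). It
tensorizes through Minkowski's inequality for exponents below one (`IsReverseHypercontractive.pi`).

Take `f(z) = P(I = i | Zⁿ = z)`. As `f ≤ f^p`, the right side is at least `p(i|xⁿ)^{1/p}`. The
operator `T` depends on `xⁿ`, but `W_x ≤ α Q` gives `T f ≤ (1 + (α - 1) p)^n η f`, where `η`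
averages with `Q` in place of `W_{x_j}` and is a Markov operator that does not see `xⁿ`
(`averageKernel_le_smul`). Thus `y ↦ (η f)(y)` is a legitimate guess of `I` from `Yⁿ`. By Gibbs'
inequality its expected logarithmic loss bounds `H(I|Yⁿ)`. Since `I` and `Yⁿ` are conditionally
independent given `Xⁿ`, this loss is at most `n ln (1 + (α - 1) p) + H(I|Xⁿ) / p`. Now use `ln (1 +
(α - 1) p) ≤ (α - 1) t` and take the infimum over `t`.

The closed form comes from the stationary point `e^t = 1 + w`, a quadratic equation in `w`. In the
discrete case, `Q` is the normalization of `y ↦ sup_x W_x(y)`. -/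

namespace RelayChannel

/-! ### Extended-valued negative logarithm and Gibbs' inequality -/

/-- `-ln a` as an extended nonnegative number, for `a ≤ 1`. -/
noncomputable def negLog (a : ℝ≥0∞) : ℝ≥0∞ := (-ENNReal.log a).toENNReal

lemma negLog_zero : negLog 0 = ∞ := by simp [negLog]

lemma negLog_ofReal {x : ℝ} (hx : 0 < x) :
    negLog (ENNReal.ofReal x) = ENNReal.ofReal (-Real.log x) := by
  rw [negLog, ENNReal.log_ofReal_of_pos hx, ← EReal.coe_neg, EReal.toENNReal_of_ne_top (by simp)]
  simp

lemma negLog_anti {a b : ℝ≥0∞} (h : a ≤ b) : negLog b ≤ negLog a :=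
  EReal.toENNReal_le_toENNReal (EReal.neg_le_neg_iff.2 (ENNReal.log_monotone h))

lemma measurable_negLog : Measurable negLog :=
  measurable_ereal_toENNReal.comp (ENNReal.measurable_log.neg)

lemma negLog_top : negLog ∞ = 0 := by simp [negLog]

lemma exists_ofReal_pos {a : ℝ≥0∞} (h0 : a ≠ 0) (ht : a ≠ ∞) :
    ∃ x : ℝ, 0 < x ∧ a = ENNReal.ofReal x :=
  ⟨a.toReal, ENNReal.toReal_pos h0 ht, (ENNReal.ofReal_toReal ht).symm⟩

lemma negLog_rpow {a : ℝ≥0∞} {r : ℝ} (hr : 0 < r) :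
    negLog (a ^ r) = ENNReal.ofReal r * negLog a := by
  rcases eq_or_ne a 0 with rfl | h0
  · rw [ENNReal.zero_rpow_of_pos hr, negLog_zero, ENNReal.mul_top]
    simpa using hr
  rcases eq_or_ne a ∞ with rfl | ht
  · simp [ENNReal.top_rpow_of_pos hr, negLog_top]
  obtain ⟨x, hx, rfl⟩ := exists_ofReal_pos h0 ht
  rw [ENNReal.ofReal_rpow_of_pos hx, negLog_ofReal (by positivity), negLog_ofReal hx,
    ← ENNReal.ofReal_mul hr.le, Real.log_rpow hx]
  congr 1
  ring

/-- A multiplicative domination costs an additive `ln c`; this is the source of the term `n ln (1 +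
(α - 1) p)`. -/
lemma negLog_le_add {a b : ℝ≥0∞} {c : ℝ} (hc : 1 ≤ c) (h : a ≤ ENNReal.ofReal c * b) :
    negLog b ≤ ENNReal.ofReal (Real.log c) + negLog a := by
  rcases eq_or_ne a 0 with rfl | h0
  · simp [negLog_zero]
  rcases eq_or_ne b ∞ with rfl | hb
  · simp [negLog_top]
  have hb0 : b ≠ 0 := by
    rintro rfl
    simp at h
    exact h0 h
  have ha : a ≠ ∞ := (h.trans_lt (ENNReal.mul_lt_top ENNReal.ofReal_lt_top hb.lt_top)).ne
  obtain ⟨x, hx, rfl⟩ := exists_ofReal_pos h0 ha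
  obtain ⟨y, hy, rfl⟩ := exists_ofReal_pos hb0 hb
  rw [← ENNReal.ofReal_mul (by linarith), ENNReal.ofReal_le_ofReal_iff (by positivity)] at h
  rw [negLog_ofReal hx, negLog_ofReal hy]
  refine le_trans (ENNReal.ofReal_le_ofReal ?_) ENNReal.ofReal_add_le
  have := Real.log_le_log hx h
  rw [Real.log_mul (by linarith) hy.ne'] at this
  linarith

lemma mul_negLog_self {a : ℝ≥0∞} (ha : a ≤ 1) :
    a * negLog a = ENNReal.ofReal (Real.negMulLog a.toReal) := by
  rcases eq_or_ne a 0 with rfl | h0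
  · simp
  obtain ⟨x, hx, rfl⟩ := exists_ofReal_pos h0 (ha.trans_lt ENNReal.one_lt_top).ne
  rw [negLog_ofReal hx, ← ENNReal.ofReal_mul hx.le, ENNReal.toReal_ofReal hx.le, Real.negMulLog]
  congr 1
  ring

/-- The pointwise form of Gibbs' inequality. -/
lemma mul_negLog_self_add_le {a b : ℝ≥0∞} (ha : a ≤ 1) (hb : b ≤ 1) :
    a * negLog a + a ≤ a * negLog b + b := by
  rcases eq_or_ne a 0 with rfl | h0
  · simp
  rcases eq_or_ne b 0 with rfl | hb0
  · simp [negLog_zero, ENNReal.mul_top h0]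
  obtain ⟨x, hx, rfl⟩ := exists_ofReal_pos h0 (ha.trans_lt ENNReal.one_lt_top).ne
  obtain ⟨y, hy, rfl⟩ := exists_ofReal_pos hb0 (hb.trans_lt ENNReal.one_lt_top).ne
  have hx1 : x ≤ 1 := by simpa using ha
  have hy1 : y ≤ 1 := by simpa using hb
  have lx := Real.log_nonpos hx.le hx1
  have ly := Real.log_nonpos hy.le hy1
  rw [negLog_ofReal hx, negLog_ofReal hy, ← ENNReal.ofReal_mul hx.le, ← ENNReal.ofReal_mul hx.le,
    ← ENNReal.ofReal_add (by nlinarith) hx.le, ← ENNReal.ofReal_add (by nlinarith) hy.le]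
  apply ENNReal.ofReal_le_ofReal
  -- `ln (y / x) ≤ y / x - 1`, multiplied by `x`.
  have h := Real.log_le_sub_one_of_pos (div_pos hy hx)
  rw [Real.log_div hy.ne' hx.ne'] at h
  have h2 := mul_le_mul_of_nonneg_left h hx.le
  have h3 : x * (y / x - 1) = y - x := by field_simp
  nlinarith

/-- Gibbs' inequality. -/
lemma tsum_mul_negLog_self_le {ι : Type*} {a b : ι → ℝ≥0∞} (ha : ∑' i, a i = 1)
    (hb : ∑' i, b i ≤ 1) : ∑' i, a i * negLog (a i) ≤ ∑' i, a i * negLog (b i) := by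
  have h := ENNReal.tsum_le_tsum (f := fun i => a i * negLog (a i) + a i)
    (g := fun i => a i * negLog (b i) + b i) fun i => mul_negLog_self_add_le
      ((ENNReal.le_tsum i).trans ha.le) ((ENNReal.le_tsum i).trans hb)
  rw [ENNReal.tsum_add, ENNReal.tsum_add, ha] at h
  exact (ENNReal.add_le_add_iff_right ENNReal.one_ne_top).1 (h.trans (by gcongr))

/-! ### One-letter reverse hypercontractivity -/

lemma hasDerivAt_logGap {p u : ℝ} (hp : 0 < p) (hp1 : p < 1) (hu : 0 < u) :
    HasDerivAt (fun u : ℝ => Real.log ((1 - p) * u + p) - (u ^ p - 1) / p + p * (u - 1))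
      ((1 - p) / ((1 - p) * u + p) - u ^ (p - 1) + p) u := by
  have hv : 0 < (1 - p) * u + p := by nlinarith [mul_pos (sub_pos.2 hp1) hu]
  have h1 : HasDerivAt (fun u : ℝ => (1 - p) * u + p) (1 - p) u := by
    simpa using ((hasDerivAt_id u).const_mul (1 - p)).add_const p
  have h2 : HasDerivAt (fun u : ℝ => (u ^ p - 1) / p) (u ^ (p - 1)) u := by
    have := ((Real.hasDerivAt_rpow_const (p := p) (Or.inl hu.ne')).sub_const 1).div_const p
    rwa [mul_div_cancel_left₀ _ hp.ne'] at this
  have h3 : HasDerivAt (fun u : ℝ => p * (u - 1)) p u := by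
    simpa using ((hasDerivAt_id u).sub_const 1).const_mul p
  exact ((h1.log hv.ne').sub h2).add h3

/-- The difference of the two sides vanishes at `u = 1`, and Bernoulli's inequality with exponent `1
- p` shows that it decreases on `[0, 1]` and increases on `[1, ∞)`. The linear term is harmless in
the application, where `u = f / 𝔼 f` has mean one. -/
lemma rpow_sub_one_div_sub_le_log {p u : ℝ} (hp : 0 < p) (hp1 : p < 1) (hu : 0 ≤ u) :
    (u ^ p - 1) / p - p * (u - 1) ≤ Real.log ((1 - p) * u + p) := by
  set k : ℝ → ℝ := fun u => Real.log ((1 - p) * u + p) - (u ^ p - 1) / p + p * (u - 1) with hk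
  have hk1 : k 1 = 0 := by simp [hk]
  suffices h : 0 ≤ k u by
    simp only [hk] at h
    linarith
  have hcont : ContinuousOn k (Ici 0) := by
    intro x hx
    have hx : 0 ≤ x := hx
    have hv : (1 - p) * x + p ≠ 0 := by nlinarith [mul_nonneg (sub_pos.2 hp1).le hx]
    apply ContinuousAt.continuousWithinAt
    have : ContinuousAt (fun u : ℝ => u ^ p) x := Real.continuousAt_rpow_const _ _ (Or.inr hp.le)
    exact ((((by fun_prop : ContinuousAt (fun u : ℝ => (1 - p) * u + p) x).log hv).sub
      ((this.sub continuousAt_const).div_const p)).add (by fun_prop))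
  rcases le_total 1 u with h1 | h1
  · have hm : MonotoneOn k (Ici 1) := by
      refine monotoneOn_of_deriv_nonneg (convex_Ici 1) (hcont.mono (Ici_subset_Ici.2 zero_le_one))
        ?_ ?_ <;> rw [interior_Ici]
      · intro x hx
        exact (hasDerivAt_logGap hp hp1
          (zero_lt_one.trans hx)).differentiableAt.differentiableWithinAt
      · intro x hx
        have hx1 : 1 < x := hx
        have hx0 : 0 < x := zero_lt_one.trans hx
        rw [(hasDerivAt_logGap hp hp1 hx0).deriv]
        have hv : 0 < (1 - p) * x + p := by nlinarith [mul_pos (sub_pos.2 hp1) hx0]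
        -- Bernoulli at `1 / x` gives `x^{p-1} ≤ p + (1 - p) / x`, and `(1 - p) x + p ≤ x` for `x >
        -- 1`.
        have hb := rpow_one_add_le_one_add_mul_self (s := x⁻¹ - 1)
          (by linarith [inv_pos.2 hx0]) (p := 1 - p) (by linarith) (by linarith)
        rw [add_sub_cancel, Real.inv_rpow hx0.le, ← Real.rpow_neg hx0.le, neg_sub] at hb
        have : (1 - p) * x⁻¹ ≤ (1 - p) / ((1 - p) * x + p) := by
          rw [← div_eq_mul_inv]
          apply div_le_div_of_nonneg_left (by linarith) hv
          nlinarith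
        nlinarith
    simpa [hk1] using hm self_mem_Ici h1 h1
  · have hm : AntitoneOn k (Icc 0 1) := by
      refine antitoneOn_of_deriv_nonpos (convex_Icc 0 1) (hcont.mono Icc_subset_Ici_self)
        ?_ ?_ <;> rw [interior_Icc]
      · intro x hx
        exact (hasDerivAt_logGap hp hp1 hx.1).differentiableAt.differentiableWithinAt
      · intro x hx
        have hx0 : 0 < x := hx.1
        rw [(hasDerivAt_logGap hp hp1 hx0).deriv]
        -- Bernoulli at `x` gives `x^{1-p} ≤ (1 - p) x + p`; then `x^{1-p} ≤ 1` absorbs the constant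
        -- `p`.
        have hb := rpow_one_add_le_one_add_mul_self (s := x - 1)
          (by linarith) (p := 1 - p) (by linarith) (by linarith)
        rw [add_sub_cancel] at hb
        have hw : 0 < x ^ (1 - p) := Real.rpow_pos_of_pos hx0 _
        have hw1 : x ^ (1 - p) ≤ 1 := Real.rpow_le_one hx0.le hx.2.le (by linarith)
        have e : x ^ (p - 1) = 1 / x ^ (1 - p) := by
          rw [one_div, ← Real.rpow_neg hx0.le, neg_sub]
        have h2 : (1 - p) / ((1 - p) * x + p) ≤ (1 - p) / x ^ (1 - p) :=
          div_le_div_of_nonneg_left (by linarith) hw (by linarith)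
        have h3 : p ≤ p / x ^ (1 - p) := by
          rw [le_div_iff₀ hw]
          nlinarith
        have h4 : 1 / x ^ (1 - p) = (1 - p) / x ^ (1 - p) + p / x ^ (1 - p) := by ring
        rw [e, h4]
        linarith
    simpa [hk1] using hm ⟨hu, h1⟩ (right_mem_Icc.2 zero_le_one) h1

/-- Reverse hypercontractivity of the simple averaging operator `(1 - p) id + p 𝔼`. -/
lemma lintegral_negLog_average_le {Ω : Type*} [MeasurableSpace Ω] (μ : Measure Ω)
    [IsProbabilityMeasure μ] {p : ℝ} (hp : 0 < p) (hp1 : p < 1) {f : Ω → ℝ≥0∞}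
    (hf : Measurable f) (hf1 : ∀ y, f y ≤ 1) :
    ∫⁻ y, negLog (ENNReal.ofReal (1 - p) * f y + ENNReal.ofReal p * ∫⁻ z, f z ∂μ) ∂μ ≤
      ENNReal.ofReal (1 / p) * negLog (∫⁻ z, f z ^ p ∂μ) := by
  set g : Ω → ℝ := fun y => (f y).toReal with hgdef
  have hfg : ∀ y, f y = ENNReal.ofReal (g y) := fun y =>
    (ENNReal.ofReal_toReal ((hf1 y).trans_lt ENNReal.one_lt_top).ne).symm
  have hgm : Measurable g := hf.ennreal_toReal
  have hg0 : ∀ y, 0 ≤ g y := fun y => ENNReal.toReal_nonneg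
  have hg1 : ∀ y, g y ≤ 1 := fun y => ENNReal.toReal_le_of_le_ofReal zero_le_one (by simpa using hf1 y)
  have hgi : Integrable g μ := Integrable.of_bound hgm.aestronglyMeasurable 1
    (ae_of_all _ fun y => by rw [Real.norm_of_nonneg (hg0 y)]; exact hg1 y)
  have hp0 : ∀ y, 0 ≤ g y ^ p := fun y => Real.rpow_nonneg (hg0 y) p
  have hgpi : Integrable (fun y => g y ^ p) μ :=
    Integrable.of_bound (hgm.pow_const p).aestronglyMeasurable 1
      (ae_of_all _ fun y => by
        rw [Real.norm_of_nonneg (hp0 y)]; exact Real.rpow_le_one (hg0 y) (hg1 y) hp.le)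
  have hI : ∫⁻ z, f z ∂μ = ENNReal.ofReal (∫ z, g z ∂μ) := by
    rw [ofReal_integral_eq_lintegral_ofReal hgi (ae_of_all _ hg0)]
    exact lintegral_congr hfg
  have hS : ∫⁻ z, f z ^ p ∂μ = ENNReal.ofReal (∫ z, g z ^ p ∂μ) := by
    rw [ofReal_integral_eq_lintegral_ofReal hgpi (ae_of_all _ hp0)]
    refine lintegral_congr fun z => ?_
    rw [hfg z, ENNReal.ofReal_rpow_of_nonneg (hg0 z) hp.le]
  set m := ∫ z, g z ∂μ with hm
  set s := ∫ z, g z ^ p ∂μ with hs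
  have hms : m ≤ s := integral_mono hgi hgpi fun y => by
    simpa using Real.rpow_le_rpow_of_exponent_ge' (hg0 y) (hg1 y) hp.le hp1.le
  have hm1 : m ≤ 1 := by
    have := integral_mono hgi (integrable_const (1 : ℝ)) hg1
    simpa using this
  have hm0 : 0 ≤ m := integral_nonneg hg0
  clear_value m s
  rcases hm0.eq_or_lt with h0 | h0
  -- If `f` vanishes almost everywhere, the right side is infinite.
  · have : g =ᵐ[μ] 0 := (integral_eq_zero_iff_of_nonneg hg0 hgi).1 (hm.symm.trans h0.symm)
    have hs0 : s = 0 := by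
      rw [hs, integral_eq_zero_of_ae]
      filter_upwards [this] with y hy
      simp [hy, Real.zero_rpow hp.ne']
    rw [hS, hs0, ENNReal.ofReal_zero, negLog_zero, ENNReal.mul_top (by simpa using hp)]
    exact le_top
  have hs0 : 0 < s := h0.trans_le hms
  rw [hS, hI, negLog_ofReal hs0, ← ENNReal.ofReal_mul (one_div_nonneg.2 hp.le)]
  -- The scalar inequality at `u = g y / m`; the last summand integrates to zero.
  set B : Ω → ℝ := fun y =>
    -Real.log m - (g y ^ p / m ^ p - 1) / p + p * (g y / m - 1) with hB
  have hmp : 0 < m ^ p := Real.rpow_pos_of_pos h0 p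
  have hle : ∀ y, -Real.log ((1 - p) * g y + p * m) ≤ B y := fun y => by
    have h := rpow_sub_one_div_sub_le_log hp hp1 (div_nonneg (hg0 y) h0.le)
    rw [Real.div_rpow (hg0 y) h0.le] at h
    have hv : 0 < (1 - p) * (g y / m) + p := by
      have := mul_nonneg (sub_pos.2 hp1).le (div_nonneg (hg0 y) h0.le)
      linarith
    have e : (1 - p) * g y + p * m = ((1 - p) * (g y / m) + p) * m := by field_simp
    rw [e, Real.log_mul hv.ne' h0.ne']
    simp only [hB]
    linarith
  have hpos : ∀ y, 0 < (1 - p) * g y + p * m := fun y => by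
    have := mul_nonneg (sub_pos.2 hp1).le (hg0 y)
    have := mul_pos hp h0
    linarith
  have hB0 : ∀ y, 0 ≤ B y := fun y => by
    refine le_trans ?_ (hle y)
    rw [neg_nonneg]
    refine Real.log_nonpos (hpos y).le ?_
    nlinarith [hg1 y]
  have hBi : Integrable B μ := by
    simp only [hB]
    fun_prop
  calc ∫⁻ y, negLog (ENNReal.ofReal (1 - p) * f y + ENNReal.ofReal p * ENNReal.ofReal m) ∂μ
      ≤ ∫⁻ y, ENNReal.ofReal (B y) ∂μ := by
        refine lintegral_mono fun y => ?_
        rw [hfg y, ← ENNReal.ofReal_mul (by linarith), ← ENNReal.ofReal_mul hp.le,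
          ← ENNReal.ofReal_add (mul_nonneg (by linarith) (hg0 y)) (by positivity),
          negLog_ofReal (hpos y)]
        exact ENNReal.ofReal_le_ofReal (hle y)
    _ = ENNReal.ofReal (∫ y, B y ∂μ) :=
        (ofReal_integral_eq_lintegral_ofReal hBi (ae_of_all _ hB0)).symm
    _ ≤ ENNReal.ofReal (1 / p * -Real.log s) := by
        apply ENNReal.ofReal_le_ofReal
        have e : ∫ y, B y ∂μ = -Real.log m - (s / m ^ p - 1) / p := by
          simp only [hB]
          rw [integral_add (by fun_prop) (by fun_prop), integral_sub (by fun_prop) (by fun_prop),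
            integral_div, integral_sub (by fun_prop) (by fun_prop), integral_const_mul,
            integral_sub (by fun_prop) (by fun_prop), integral_div, integral_div, ← hm, ← hs]
          rw [div_self h0.ne']
          simp
        -- `ln (s / m^p) ≤ s / m^p - 1`, divided by `p`: the terms in `ln m` cancel.
        have h := Real.log_le_sub_one_of_pos (div_pos hs0 hmp)
        rw [Real.log_div hs0.ne' hmp.ne', Real.log_rpow h0] at h
        have h2 := div_le_div_of_nonneg_right h hp.le
        rw [e]
        have e3 : (Real.log s - p * Real.log m) / p = 1 / p * Real.log s - Real.log m := by
          field_simp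
        rw [e3] at h2
        linarith

/-! ### Minkowski's inequality and tensorization -/

/-- Minkowski's integral inequality for an exponent `p < 1`. -/
lemma rpow_lintegral_rpow_le {α β : Type*} [MeasurableSpace α] [MeasurableSpace β]
    (μ : Measure α) (ν : Measure β) [IsProbabilityMeasure μ] [IsProbabilityMeasure ν]
    {p : ℝ} (hp : 0 < p) (hp1 : p < 1) {F : α → β → ℝ≥0∞}
    (hF : Measurable (Function.uncurry F)) (hF1 : ∀ a b, F a b ≤ 1) :
    (∫⁻ b, (∫⁻ a, F a b ^ p ∂μ) ^ (1 / p) ∂ν) ^ p ≤ ∫⁻ a, (∫⁻ b, F a b ∂ν) ^ p ∂μ := by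
  set S : β → ℝ≥0∞ := fun b => ∫⁻ a, F a b ^ p ∂μ with hS
  have hSm : Measurable S := (hF.pow_const p).lintegral_prod_left'
  have hS1 : ∀ b, S b ≤ 1 := fun b => by
    calc S b ≤ ∫⁻ _, 1 ∂μ := lintegral_mono fun a => ENNReal.rpow_le_one (hF1 a b) hp.le
      _ = 1 := by simp
  set A := ∫⁻ b, S b ^ (1 / p) ∂ν with hA
  have hA1 : A ≤ 1 := by
    calc A ≤ ∫⁻ _, 1 ∂ν := lintegral_mono fun b => ENNReal.rpow_le_one (hS1 b) (by positivity)
      _ = 1 := by simp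
  rcases eq_or_ne A 0 with h0 | h0
  · simp [h0, hp]
  have hAt : A ≠ ∞ := (hA1.trans_lt ENNReal.one_lt_top).ne
  have hr : 0 ≤ 1 / p - 1 := by
    rw [sub_nonneg, le_div_iff₀ hp]
    linarith
  have hconj : (1 / (1 - p)).HolderConjugate (1 / p) := by
    rw [Real.holderConjugate_iff]
    refine ⟨?_, by simp⟩
    rw [lt_div_iff₀ (by linarith)]
    linarith
  -- Write `S^{1/p} = S^{1/p-1} S`, exchange the integrals and apply Hölder with exponents `1 / (1 -
  -- p)` and `1 / p`. Since `0 < A ≤ 1`, the factor `A^{1-p}` can then be cancelled.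
  have key : A ≤ A ^ (1 - p) * ∫⁻ a, (∫⁻ b, F a b ∂ν) ^ p ∂μ := by
    calc A = ∫⁻ b, ∫⁻ a, S b ^ (1 / p - 1) * F a b ^ p ∂μ ∂ν := by
          refine lintegral_congr fun b => ?_
          have hFb : Measurable fun a => F a b := hF.comp measurable_prodMk_right
          rw [lintegral_const_mul _ (hFb.pow_const p)]
          change S b ^ (1 / p) = S b ^ (1 / p - 1) * S b
          conv_rhs => rw [← ENNReal.rpow_one (S b), ← ENNReal.rpow_mul]
          rw [← ENNReal.rpow_add_of_nonneg _ _ (by simpa using hr) zero_le_one]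
          simp
      _ = ∫⁻ a, ∫⁻ b, S b ^ (1 / p - 1) * F a b ^ p ∂ν ∂μ := by
          refine lintegral_lintegral_swap (Measurable.aemeasurable ?_)
          exact ((hSm.comp measurable_fst).pow_const _).mul
            ((hF.comp measurable_swap).pow_const p)
      _ ≤ ∫⁻ a, A ^ (1 - p) * (∫⁻ b, F a b ∂ν) ^ p ∂μ := by
          refine lintegral_mono fun a => ?_
          refine (ENNReal.lintegral_mul_le_Lp_mul_Lq ν hconj (hSm.pow_const _).aemeasurable
            ((hF.comp measurable_prodMk_left).pow_const p).aemeasurable).trans_eq ?_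
          have e1 : (1 / p - 1) * (1 / (1 - p)) = 1 / p := by
            have : 1 - p ≠ 0 := by linarith
            field_simp
          simp only [← ENNReal.rpow_mul, e1, one_div_one_div, mul_one_div_cancel hp.ne',
            ENNReal.rpow_one, hA]
          rfl
      _ = A ^ (1 - p) * ∫⁻ a, (∫⁻ b, F a b ∂ν) ^ p ∂μ :=
          lintegral_const_mul _ (hF.lintegral_prod_right'.pow_const p)
  have hc0 : A ^ (1 - p) ≠ 0 := (ENNReal.rpow_pos (pos_iff_ne_zero.2 h0) hAt).ne'
  have hct : A ^ (1 - p) ≠ ∞ := ENNReal.rpow_ne_top_of_nonneg (by linarith) hAt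
  refine (ENNReal.mul_le_mul_iff_right hc0 hct).1 (le_trans (le_of_eq ?_) key)
  rw [← ENNReal.rpow_add _ _ h0 hAt]
  simp

/-- The product of the Markov kernels `κ i`. -/
noncomputable def productKernel {α β : Type*} [MeasurableSpace α] [MeasurableSpace β] {n : ℕ}
    (κ : Fin n → Kernel α β) [∀ i, IsMarkovKernel (κ i)] : Kernel (Fin n → α) (Fin n → β) where
  toFun x := Measure.pi (fun i => κ i (x i))
  measurable' := by
    refine Measurable.measure_of_isPiSystem_of_isProbabilityMeasure
      (S := Set.pi univ '' Set.pi univ fun _ : Fin n => {s : Set β | MeasurableSet s})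
      generateFrom_pi.symm isPiSystem_pi ?_
    rintro _ ⟨s, hs, rfl⟩
    simp only [Measure.pi_pi]
    refine Finset.measurable_prod _ fun i _ => ?_
    exact ((κ i).measurable_coe (hs i (mem_univ i))).comp (measurable_pi_apply i)

instance {α β : Type*} [MeasurableSpace α] [MeasurableSpace β] {n : ℕ}
    (κ : Fin n → Kernel α β) [∀ i, IsMarkovKernel (κ i)] : IsMarkovKernel (productKernel κ) :=
  ⟨fun x => by
    change IsProbabilityMeasure (Measure.pi (fun i => κ i (x i)))
    infer_instance⟩

lemma productKernel_apply {α β : Type*} [MeasurableSpace α] [MeasurableSpace β] {n : ℕ}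
    (κ : Fin n → Kernel α β) [∀ i, IsMarkovKernel (κ i)] (x : Fin n → α) :
    productKernel κ x = Measure.pi (fun i => κ i (x i)) := rfl

lemma measurable_finCons {Ω : Type*} [MeasurableSpace Ω] {n : ℕ} :
    Measurable fun z : (Fin n → Ω) × Ω => (Fin.cons z.2 z.1 : Fin (n + 1) → Ω) := by
  refine measurable_pi_lambda _ fun i => ?_
  refine Fin.cases ?_ (fun j => ?_) i
  · simpa using measurable_snd
  · simp only [Fin.cons_succ]
    exact (measurable_pi_apply j).comp measurable_fst

lemma lintegral_pi_succ {Ω : Type*} [MeasurableSpace Ω] {n : ℕ} (μ : Fin (n + 1) → Measure Ω)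
    [∀ i, SigmaFinite (μ i)] {f : (Fin (n + 1) → Ω) → ℝ≥0∞} (hf : Measurable f) :
    ∫⁻ z, f z ∂Measure.pi μ =
      ∫⁻ b, ∫⁻ a, f (Fin.cons a b) ∂μ 0 ∂Measure.pi fun i : Fin n => μ i.succ := by
  have h := (measurePreserving_piFinSuccAbove μ 0).symm
  rw [← h.lintegral_comp hf, lintegral_prod_symm (fun z => f _) (hf.comp h.measurable).aemeasurable]
  simp [MeasurableEquiv.piFinSuccAbove, Fin.insertNthEquiv]

/-- Monotonicity of product measures, with constants. -/
lemma lintegral_pi_le_of_le_smul {Ω : Type*} [MeasurableSpace Ω] {c : ℝ≥0∞} {n : ℕ}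
    (μ ν : Fin n → Measure Ω) [∀ i, IsFiniteMeasure (μ i)] [∀ i, IsFiniteMeasure (ν i)]
    (h : ∀ i, μ i ≤ c • ν i) {f : (Fin n → Ω) → ℝ≥0∞} (hf : Measurable f) :
    ∫⁻ z, f z ∂Measure.pi μ ≤ c ^ n * ∫⁻ z, f z ∂Measure.pi ν := by
  induction n with
  | zero => simp [Measure.pi_of_empty μ, Measure.pi_of_empty ν]
  | succ n ih =>
    have hm : Measurable fun b : Fin n → Ω => ∫⁻ a, f (Fin.cons a b) ∂ν 0 :=
      (hf.comp measurable_finCons).lintegral_prod_right'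
    rw [lintegral_pi_succ μ hf, lintegral_pi_succ ν hf]
    calc _ ≤ ∫⁻ b, c * ∫⁻ a, f (Fin.cons a b) ∂ν 0 ∂Measure.pi fun i : Fin n => μ i.succ := by
          refine lintegral_mono fun b => ?_
          rw [← smul_eq_mul, ← lintegral_smul_measure]
          exact lintegral_mono' (h 0) le_rfl
      _ ≤ c ^ n * ∫⁻ b, c * ∫⁻ a, f (Fin.cons a b) ∂ν 0 ∂Measure.pi fun i : Fin n => ν i.succ :=
          ih _ _ (fun i => h i.succ) (hm.const_mul c)
      _ = _ := by rw [lintegral_const_mul _ hm, pow_succ, mul_assoc]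

/-- Reverse hypercontractivity of a kernel, from exponent `p` to exponent `0`. -/
def IsReverseHypercontractive {Ω : Type*} [MeasurableSpace Ω] (p : ℝ) (κ : Kernel Ω Ω)
    (μ : Measure Ω) : Prop :=
  ∀ f : Ω → ℝ≥0∞, Measurable f → (∀ y, f y ≤ 1) →
    ∫⁻ y, negLog (∫⁻ z, f z ∂κ y) ∂μ ≤ ENNReal.ofReal (1 / p) * negLog (∫⁻ z, f z ^ p ∂μ)

/-- Reverse hypercontractivity tensorizes. -/
theorem IsReverseHypercontractive.pi {Ω : Type*} [MeasurableSpace Ω] {p : ℝ} (hp : 0 < p)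
    (hp1 : p < 1) {n : ℕ} (κ : Fin n → Kernel Ω Ω) (μ : Fin n → Measure Ω)
    [∀ i, IsMarkovKernel (κ i)] [∀ i, IsProbabilityMeasure (μ i)]
    (h : ∀ i, IsReverseHypercontractive p (κ i) (μ i)) :
    IsReverseHypercontractive p (productKernel κ) (Measure.pi μ) := by
  have hpp : ENNReal.ofReal (1 / p) * ENNReal.ofReal p = 1 := by
    rw [← ENNReal.ofReal_mul (by positivity)]
    simp [hp.ne']
  induction n with
  | zero =>
    intro f hf hf1
    have e : ∀ y, ∫⁻ z, f z ∂productKernel κ y = f y := fun y => by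
      rw [productKernel_apply, Measure.pi_of_empty _ y, lintegral_dirac]
    simp_rw [e]
    rw [Measure.pi_of_empty μ, lintegral_dirac, lintegral_dirac, negLog_rpow hp, ← mul_assoc, hpp,
      one_mul]
  | succ n ih =>
    intro f hf hf1
    set K := productKernel fun i : Fin n => κ i.succ with hK
    set ν := Measure.pi fun i : Fin n => μ i.succ with hν
    have hfc : Measurable fun z : (Fin n → Ω) × Ω => f (Fin.cons z.2 z.1) :=
      hf.comp measurable_finCons
    set G : (Fin n → Ω) → Ω → ℝ≥0∞ := fun b a => ∫⁻ z, f (Fin.cons a z) ∂K b with hG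
    have hGm : ∀ b, Measurable (G b) := fun b => hfc.lintegral_prod_left'
    have hG1 : ∀ b a, G b a ≤ 1 := fun b a => by
      calc G b a ≤ ∫⁻ _, 1 ∂K b := lintegral_mono fun z => hf1 _
        _ = 1 := by simp
    -- The partial `L^p` norm in the first coordinate: `g^p` integrates to the full integral of
    -- `f^p`, as the induction hypothesis requires.
    set g : (Fin n → Ω) → ℝ≥0∞ := fun z => (∫⁻ a, f (Fin.cons a z) ^ p ∂μ 0) ^ (1 / p) with hg
    have hgm : Measurable g := (hfc.pow_const p).lintegral_prod_right'.pow_const _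
    have hg1 : ∀ z, g z ≤ 1 := fun z => by
      refine ENNReal.rpow_le_one ?_ (by positivity)
      calc _ ≤ ∫⁻ _, 1 ∂μ 0 := lintegral_mono fun a => ENNReal.rpow_le_one (hf1 _) hp.le
        _ = 1 := by simp
    have e1 : ∀ a b, ∫⁻ z, f z ∂productKernel κ (Fin.cons a b) = ∫⁻ a', G b a' ∂κ 0 a := by
      intro a b
      rw [productKernel_apply, lintegral_pi_succ _ hf]
      simp only [Fin.cons_zero, Fin.cons_succ]
      rw [lintegral_lintegral_swap hfc.aemeasurable]
      rfl
    have hLm : Measurable fun y => negLog (∫⁻ z, f z ∂productKernel κ y) :=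
      measurable_negLog.comp hf.lintegral_kernel
    have e2 : ∀ z, g z ^ p = ∫⁻ a, f (Fin.cons a z) ^ p ∂μ 0 := fun z => by
      rw [hg, ← ENNReal.rpow_mul, one_div_mul_cancel hp.ne', ENNReal.rpow_one]
    rw [lintegral_pi_succ μ hLm, lintegral_pi_succ μ (hf.pow_const p)]
    simp_rw [e1, ← e2]
    -- For fixed `b`, the one-letter inequality applies to `G b`; Minkowski exchanges the `L^p` norm
    -- under `μ 0` with integration against `K b`, leaving `K` applied to `g`.
    refine le_trans (lintegral_mono fun b => ?_) (ih _ _ (fun i => h i.succ) g hgm hg1)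
    refine (h 0 (G b) (hGm b) (hG1 b)).trans ?_
    have hmink := rpow_lintegral_rpow_le (μ 0) (K b) hp hp1 (F := fun a z => f (Fin.cons a z))
      (hfc.comp measurable_swap) fun _ _ => hf1 _
    calc _ ≤ ENNReal.ofReal (1 / p) * negLog ((∫⁻ z, g z ∂K b) ^ p) := by
          gcongr
          exact negLog_anti hmink
      _ = negLog (∫⁻ z, g z ∂K b) := by rw [negLog_rpow hp, ← mul_assoc, hpp, one_mul]

/-! ### The averaging kernel -/

/-- The kernel `(1 - p) id + p μ`. -/
noncomputable def averageKernel {Ω : Type*} [MeasurableSpace Ω] (p : ℝ) (μ : Measure Ω) :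
    Kernel Ω Ω where
  toFun y := ENNReal.ofReal (1 - p) • Measure.dirac y + ENNReal.ofReal p • μ
  measurable' := by
    refine Measure.measurable_of_measurable_coe _ fun s hs => ?_
    simp only [Measure.add_apply, Measure.smul_apply, smul_eq_mul]
    exact ((Measure.measurable_coe hs).comp Measure.measurable_dirac).const_mul _ |>.add_const _

lemma averageKernel_apply {Ω : Type*} [MeasurableSpace Ω] (p : ℝ) (μ : Measure Ω) (y : Ω) :
    averageKernel p μ y = ENNReal.ofReal (1 - p) • Measure.dirac y + ENNReal.ofReal p • μ := rfl

lemma isMarkovKernel_averageKernel {Ω : Type*} [MeasurableSpace Ω] {p : ℝ} (hp : 0 ≤ p)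
    (hp1 : p ≤ 1) (μ : Measure Ω) [IsProbabilityMeasure μ] :
    IsMarkovKernel (averageKernel p μ) :=
  ⟨fun y => ⟨by
    rw [averageKernel_apply, Measure.add_apply, Measure.smul_apply, Measure.smul_apply,
      measure_univ, measure_univ, smul_eq_mul, smul_eq_mul, mul_one, mul_one,
      ← ENNReal.ofReal_add (by linarith) hp]
    simp⟩⟩

lemma isReverseHypercontractive_averageKernel {Ω : Type*} [MeasurableSpace Ω] {p : ℝ} (hp : 0 < p)
    (hp1 : p < 1) (μ : Measure Ω) [IsProbabilityMeasure μ] :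
    IsReverseHypercontractive p (averageKernel p μ) μ := by
  intro f hf hf1
  simp_rw [averageKernel_apply, lintegral_add_measure, lintegral_smul_measure,
    lintegral_dirac' _ hf]
  exact lintegral_negLog_average_le μ hp hp1 hf hf1

/-! ### Conditional laws, Markov chains and conditional entropy -/

lemma HasCondLaw.lintegral_eq {S 𝓐 𝓑 : Type*} [MeasurableSpace S] [MeasurableSpace 𝓐]
    [MeasurableSpace 𝓑] {P : Measure S} [IsFiniteMeasure P] {B : S → 𝓑} {A : S → 𝓐}
    {κ : Kernel 𝓐 𝓑} [IsMarkovKernel κ] (h : HasCondLaw P B A κ) (hA : Measurable A)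
    (hB : Measurable B) {g : 𝓐 × 𝓑 → ℝ≥0∞} (hg : Measurable g) :
    ∫⁻ ω, g (A ω, B ω) ∂P = ∫⁻ ω, ∫⁻ b, g (A ω, b) ∂κ (A ω) ∂P := by
  rw [← lintegral_map hg (hA.prodMk hB), h, Measure.lintegral_compProd hg,
    lintegral_map (hg.lintegral_kernel_prod_right') hA]

/-- Two conditional laws of `Z` given `X` integrate a given function alike, almost surely. -/
lemma HasCondLaw.lintegral_ae_eq {S 𝓐 𝓑 : Type*} [MeasurableSpace S]
    [MeasurableSpace 𝓐] [MeasurableSpace 𝓑] {P : Measure S}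
    [IsFiniteMeasure P] {Z : S → 𝓑} {X : S → 𝓐} {κ V : Kernel 𝓐 𝓑}
    [IsMarkovKernel κ] [IsMarkovKernel V] (hκ : HasCondLaw P Z X κ)
    (hV : HasCondLaw P Z X V) (hX : Measurable X) (hZ : Measurable Z)
    {f : 𝓑 → ℝ≥0∞} (hf : Measurable f) :
    ∀ᵐ ω ∂P, ∫⁻ z, f z ∂κ (X ω) = ∫⁻ z, f z ∂V (X ω) := by
  refine ae_of_ae_map hX.aemeasurable (p := fun x => ∫⁻ z, f z ∂κ x = ∫⁻ z, f z ∂V x) ?_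
  refine ae_eq_of_forall_setLIntegral_eq_of_sigmaFinite hf.lintegral_kernel hf.lintegral_kernel
    fun s hs _ => ?_
  -- Over any measurable `s`, either version integrates to `𝔼[1_s(X) f(Z)]`.
  have key : ∀ (κ : Kernel 𝓐 𝓑) [IsMarkovKernel κ], HasCondLaw P Z X κ →
      ∫⁻ x in s, ∫⁻ z, f z ∂κ x ∂P.map X = ∫⁻ ω, s.indicator 1 (X ω) * f (Z ω) ∂P := by
    intro κ _ hκ
    have hs1 : Measurable (s.indicator (1 : 𝓐 → ℝ≥0∞)) := measurable_one.indicator hs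
    rw [hκ.lintegral_eq hX hZ (g := fun q => s.indicator 1 q.1 * f q.2)
      ((hs1.comp measurable_fst).mul (hf.comp measurable_snd)), ← lintegral_indicator hs,
      lintegral_map (hf.lintegral_kernel.indicator hs) hX]
    refine lintegral_congr fun ω => ?_
    dsimp only
    rw [lintegral_const_mul _ hf]
    by_cases h : X ω ∈ s <;> simp [h]
  rw [key κ hκ, key V hV]

lemma HasCondLaw.of_prodMkRight {S 𝓐 𝓑 𝓒 : Type*} [MeasurableSpace S] [MeasurableSpace 𝓐]
    [MeasurableSpace 𝓑] [MeasurableSpace 𝓒] {P : Measure S} [IsFiniteMeasure P] {A : S → 𝓐}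
    {B : S → 𝓑} {C : S → 𝓒} {κ : Kernel 𝓑 𝓐} [IsMarkovKernel κ] (hA : Measurable A)
    (hB : Measurable B) (hC : Measurable C)
    (h : HasCondLaw P A (fun ω => (B ω, C ω)) (κ.prodMkRight 𝓒)) : HasCondLaw P A B κ := by
  refine Measure.ext_of_lintegral _ fun g hg => ?_
  rw [lintegral_map hg (hB.prodMk hA), Measure.lintegral_compProd hg,
    lintegral_map hg.lintegral_kernel_prod_right' hB]
  exact h.lintegral_eq (hB.prodMk hC) hA (g := fun q => g (q.1.1, q.2)) (by fun_prop)

/-- In a Markov chain `I – Z – X – Y` with `P_{Z|X} = V`, the conditional law of `I` given `(X, Y)`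
is obtained by passing `X` through `V` and then through the conditional law of `I` given `Z`. -/
lemma lintegral_markovChain {S ι 𝓐 𝓑 𝓒 : Type*} [MeasurableSpace S] [MeasurableSpace ι]
    [Countable ι] [DiscreteMeasurableSpace ι] [MeasurableSpace 𝓐] [MeasurableSpace 𝓑]
    [MeasurableSpace 𝓒] {P : Measure S} [IsFiniteMeasure P] {I : S → ι} {Z : S → 𝓒} {X : S → 𝓐}
    {Y : S → 𝓑} (hI : Measurable I) (hZ : Measurable Z) (hX : Measurable X) (hY : Measurable Y)
    {κ : Kernel 𝓒 ι} [IsMarkovKernel κ]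
    (hκ : HasCondLaw P I (fun ω => (Z ω, (X ω, Y ω))) (κ.prodMkRight (𝓐 × 𝓑)))
    (hZXY : IsMarkovTriple P Z X Y) {V : Kernel 𝓐 𝓒} [IsMarkovKernel V] (hV : HasCondLaw P Z X V)
    {g : (𝓐 × 𝓑) × ι → ℝ≥0∞} (hg : Measurable g) :
    ∫⁻ ω, g ((X ω, Y ω), I ω) ∂P =
      ∫⁻ ω, ∑' i, (κ ∘ₖ V) (X ω) {i} * g ((X ω, Y ω), i) ∂P := by
  obtain ⟨κ', _, hκ'⟩ := hZXY
  -- The Markov property supplies its own kernel `κ'` from `X` to `Z`; it may be replaced by `V`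
  -- almost surely, one `i` at a time.
  have hae := fun i => (hκ'.of_prodMkRight hZ hX hY).lintegral_ae_eq hV hX hZ
    (κ.measurable_coe (measurableSet_singleton i))
  have hgi : ∀ i, Measurable fun q => g (q, i) := fun i => hg.comp measurable_prodMk_right
  have hκi : ∀ i, Measurable fun z => κ z {i} := fun i => κ.measurable_coe (measurableSet_singleton i)
  have hρi : ∀ i, Measurable fun x => (κ ∘ₖ V) x {i} := fun i =>
    (κ ∘ₖ V).measurable_coe (measurableSet_singleton i)
  calc ∫⁻ ω, g ((X ω, Y ω), I ω) ∂P
      = ∫⁻ ω, ∑' i, κ (Z ω) {i} * g ((X ω, Y ω), i) ∂P := by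
        rw [hκ.lintegral_eq (hZ.prodMk (hX.prodMk hY)) hI (g := fun q => g (q.1.2, q.2))
          (by fun_prop)]
        refine lintegral_congr fun ω => ?_
        rw [lintegral_countable']
        exact tsum_congr fun i => mul_comm _ _
    _ = ∑' i, ∫⁻ ω, κ (Z ω) {i} * g ((X ω, Y ω), i) ∂P :=
        lintegral_tsum fun i => (((hκi i).comp hZ).mul
          ((hgi i).comp (hX.prodMk hY))).aemeasurable
    _ = ∑' i, ∫⁻ ω, (κ ∘ₖ V) (X ω) {i} * g ((X ω, Y ω), i) ∂P := by
        refine tsum_congr fun i => ?_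
        rw [hκ'.lintegral_eq (hX.prodMk hY) hZ (g := fun q => κ q.2 {i} * g (q.1, i))
          (((hκi i).comp measurable_snd).mul ((hgi i).comp measurable_fst))]
        refine lintegral_congr_ae ?_
        filter_upwards [hae i] with ω hω
        rw [lintegral_mul_const _ (hκi i), Kernel.comp_apply' _ _ _ (measurableSet_singleton i),
          ← hω]
        rfl
    _ = _ := (lintegral_tsum fun i => (((hρi i).comp hX).mul
          ((hgi i).comp (hX.prodMk hY))).aemeasurable).symm

/-- By almost sure uniqueness of conditional laws, the entropy can be computed from any version,
here `κ ∘ₖ V` as well as `condDistrib`. -/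
lemma condEntropy_eq_lintegral {S ι 𝓤 : Type*} [MeasurableSpace S] [MeasurableSpace ι]
    [MeasurableSpace 𝓤] [Countable ι] [DiscreteMeasurableSpace ι] [Nonempty ι]
    {P : Measure S} [IsFiniteMeasure P] {I : S → ι} {U : S → 𝓤} (hI : Measurable I)
    (hU : Measurable U) {κ : Kernel 𝓤 ι} [IsMarkovKernel κ] (h : HasCondLaw P I U κ) :
    condEntropy P I U = ∫⁻ ω, ∑' i, κ (U ω) {i} * negLog (κ (U ω) {i}) ∂P := by
  have hm : Measurable fun u => ∑' i, κ u {i} * negLog (κ u {i}) := by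
    refine Measurable.tsum fun i => ?_
    have := κ.measurable_coe (measurableSet_singleton i)
    exact this.mul (measurable_negLog.comp this)
  rw [condEntropy, ← lintegral_map hm hU]
  refine lintegral_congr_ae ?_
  filter_upwards [condDistrib_ae_eq_of_measure_eq_compProd U hI.aemeasurable h] with u hu
  rw [hu]
  exact tsum_congr fun i => (mul_negLog_self prob_le_one).symm

lemma tsum_measure_singleton {ι : Type*} [MeasurableSpace ι] [Countable ι]
    [DiscreteMeasurableSpace ι] (μ : Measure ι) : ∑' i, μ {i} = μ univ := by
  rw [← lintegral_one, lintegral_countable']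
  simp

/-- A bound on the conditional entropy at the end of a Markov chain `I – Z – X – Y`, by means of an
auxiliary channel `η` that estimates `I` from `Y`. -/
theorem condEntropy_le_of_lintegral_negLog_le {S ι 𝓐 𝓑 𝓒 : Type*} [MeasurableSpace S]
    [MeasurableSpace ι] [Countable ι] [DiscreteMeasurableSpace ι] [Nonempty ι] [MeasurableSpace 𝓐]
    [MeasurableSpace 𝓑] [MeasurableSpace 𝓒] {P : Measure S} [IsProbabilityMeasure P] {I : S → ι}
    {Z : S → 𝓒} {X : S → 𝓐} {Y : S → 𝓑} (hI : Measurable I) (hZ : Measurable Z)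
    (hX : Measurable X) (hY : Measurable Y) {κ : Kernel 𝓒 ι} [IsMarkovKernel κ]
    (hκ : HasCondLaw P I (fun ω => (Z ω, (X ω, Y ω))) (κ.prodMkRight (𝓐 × 𝓑)))
    (hZXY : IsMarkovTriple P Z X Y) {V : Kernel 𝓐 𝓒} [IsMarkovKernel V] (hV : HasCondLaw P Z X V)
    {V' : Kernel 𝓐 𝓑} [IsMarkovKernel V'] (hV' : HasCondLaw P Y X V')
    {η : Kernel 𝓑 ι} [IsMarkovKernel η] {a b : ℝ≥0∞}
    (h : ∀ x i, ∫⁻ y, negLog (η y {i}) ∂V' x ≤ a + b * negLog ((κ ∘ₖ V) x {i})) :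
    condEntropy P I Y ≤ a + b * condEntropy P I X := by
  have hρ : HasCondLaw P I X (κ ∘ₖ V) := by
    refine Measure.ext_of_lintegral _ fun g hg => ?_
    rw [lintegral_map hg (hX.prodMk hI), Measure.lintegral_compProd hg,
      lintegral_map hg.lintegral_kernel_prod_right' hX,
      lintegral_markovChain hI hZ hX hY hκ hZXY hV (g := fun q => g (q.1.1, q.2)) (by fun_prop)]
    refine lintegral_congr fun ω => ?_
    rw [lintegral_countable']
    exact tsum_congr fun i => mul_comm _ _
  have hc : HasCondLaw P I Y (condDistrib I Y P) :=
    (compProd_map_condDistrib hI.aemeasurable).symm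
  have hηi : ∀ i, Measurable fun y => negLog (η y {i}) := fun i =>
    measurable_negLog.comp (η.measurable_coe (measurableSet_singleton i))
  have hη : Measurable fun q : 𝓑 × ι => negLog (η q.1 {q.2}) :=
    measurable_from_prod_countable_left hηi
  have hρi : ∀ i, Measurable fun x => (κ ∘ₖ V) x {i} := fun i =>
    (κ ∘ₖ V).measurable_coe (measurableSet_singleton i)
  have hone : ∀ x, ∑' i, (κ ∘ₖ V) x {i} = 1 := fun x => by
    rw [tsum_measure_singleton, measure_univ]
  calc condEntropy P I Y
      ≤ ∫⁻ ω, ∑' i, condDistrib I Y P (Y ω) {i} * negLog (η (Y ω) {i}) ∂P := by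
        rw [condEntropy_eq_lintegral hI hY hc]
        refine lintegral_mono fun ω => tsum_mul_negLog_self_le ?_ ?_
        · rw [tsum_measure_singleton, measure_univ]
        · rw [tsum_measure_singleton, measure_univ]
    _ = ∫⁻ ω, negLog (η (Y ω) {I ω}) ∂P := by
        rw [hc.lintegral_eq hY hI hη]
        refine lintegral_congr fun ω => ?_
        rw [lintegral_countable']
        exact tsum_congr fun i => mul_comm _ _
    -- Given `(X, Y)`, the law of `I` depends on `X` only, so for each `i` it remains to average the
    -- loss over `Y` given `X`, which `h` controls.
    _ = ∫⁻ ω, ∑' i, (κ ∘ₖ V) (X ω) {i} * negLog (η (Y ω) {i}) ∂P :=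
        lintegral_markovChain hI hZ hX hY hκ hZXY hV
          (g := fun q => negLog (η q.1.2 {q.2}))
          (hη.comp (by fun_prop : Measurable fun q : (𝓐 × 𝓑) × ι => (q.1.2, q.2)))
    _ = ∑' i, ∫⁻ ω, (κ ∘ₖ V) (X ω) {i} * negLog (η (Y ω) {i}) ∂P :=
        lintegral_tsum fun i => (((hρi i).comp hX).mul ((hηi i).comp hY)).aemeasurable
    _ ≤ ∑' i, ∫⁻ ω, (κ ∘ₖ V) (X ω) {i} * (a + b * negLog ((κ ∘ₖ V) (X ω) {i})) ∂P := by
        refine ENNReal.tsum_le_tsum fun i => ?_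
        rw [hV'.lintegral_eq hX hY (g := fun q => (κ ∘ₖ V) q.1 {i} * negLog (η q.2 {i}))
          (((hρi i).comp measurable_fst).mul ((hηi i).comp measurable_snd))]
        refine lintegral_mono fun ω => ?_
        dsimp only
        rw [lintegral_const_mul _ (hηi i)]
        gcongr
        exact h _ i
    _ = ∫⁻ ω, ∑' i, (κ ∘ₖ V) (X ω) {i} * (a + b * negLog ((κ ∘ₖ V) (X ω) {i})) ∂P :=
        (lintegral_tsum fun i => (((hρi i).comp hX).mul (((measurable_negLog.comp
          ((hρi i).comp hX)).const_mul b).const_add a)).aemeasurable).symm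
    _ = ∫⁻ ω, (a + b * ∑' i, (κ ∘ₖ V) (X ω) {i} * negLog ((κ ∘ₖ V) (X ω) {i})) ∂P := by
        refine lintegral_congr fun ω => ?_
        simp_rw [mul_add, ENNReal.tsum_add, ENNReal.tsum_mul_right, hone, one_mul,
          mul_left_comm _ b, ENNReal.tsum_mul_left]
    _ = a + b * condEntropy P I X := by
        rw [condEntropy_eq_lintegral hI hX hρ, lintegral_add_left measurable_const, lintegral_const_mul]
        · simp
        · refine Measurable.tsum fun i => ?_
          exact ((hρi i).comp hX).mul (measurable_negLog.comp ((hρi i).comp hX))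

/-! ### Density bounds and the entropy inequality -/

lemma le_essSup_rnDeriv_smul {Ω : Type*} [MeasurableSpace Ω] {μ ν : Measure Ω} [IsFiniteMeasure μ]
    [IsFiniteMeasure ν] (h : μ ≪ ν) : μ ≤ essSup (μ.rnDeriv ν) ν • ν := by
  calc μ = ν.withDensity (μ.rnDeriv ν) := (Measure.withDensity_rnDeriv_eq μ ν h).symm
    _ ≤ ν.withDensity fun _ => essSup (μ.rnDeriv ν) ν := withDensity_mono (ENNReal.ae_le_essSup _)
    _ = essSup (μ.rnDeriv ν) ν • ν := withDensity_const _

lemma essSup_rnDeriv_le_of_le_smul {Ω : Type*} [MeasurableSpace Ω] {μ ν : Measure Ω}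
    [IsFiniteMeasure ν] {c : ℝ≥0∞} (h : μ ≤ c • ν) : essSup (μ.rnDeriv ν) ν ≤ c := by
  refine essSup_le_of_ae_le _ (ae_le_of_forall_setLIntegral_le_of_sigmaFinite
    (Measure.measurable_rnDeriv μ ν) fun s _ _ => ?_)
  calc _ ≤ μ s := Measure.setLIntegral_rnDeriv_le s
    _ ≤ (c • ν) s := h s
    _ = _ := by simp

lemma le_densityBound_smul {𝓧 Ω : Type*} [MeasurableSpace 𝓧] [MeasurableSpace Ω]
    (W : Kernel 𝓧 Ω) [IsMarkovKernel W] (Q : Measure Ω) [IsFiniteMeasure Q] (x : 𝓧)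
    (h : W x ≪ Q) : W x ≤ densityBound W Q • Q :=
  (le_essSup_rnDeriv_smul h).trans fun s => by
    simp only [Measure.smul_apply, smul_eq_mul]
    gcongr
    exact le_iSup (fun x => essSup ((W x).rnDeriv Q) Q) x

lemma one_le_densityBound {𝓧 Ω : Type*} [MeasurableSpace 𝓧] [MeasurableSpace Ω] [Nonempty 𝓧]
    (W : Kernel 𝓧 Ω) [IsMarkovKernel W] (Q : Measure Ω) [IsProbabilityMeasure Q]
    (h : ∀ x, W x ≪ Q) : 1 ≤ densityBound W Q := by
  obtain ⟨x⟩ := ‹Nonempty 𝓧›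
  simpa using le_densityBound_smul W Q x (h x) univ

/-- Replacing `μ` by `α Q` gives a measure of mass `1 - p + α p = 1 + (α - 1) p`; dividing by this
mass yields an averaging kernel for `Q` with weight `α p / (1 + (α - 1) p)`. -/
lemma averageKernel_le_smul {Ω : Type*} [MeasurableSpace Ω] {μ Q : Measure Ω} {α p : ℝ}
    (hα : 1 ≤ α) (hp : 0 ≤ p) (h : μ ≤ ENNReal.ofReal α • Q) (y : Ω) :
    averageKernel p μ y ≤
      ENNReal.ofReal (1 + (α - 1) * p) • averageKernel (α * p / (1 + (α - 1) * p)) Q y := by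
  have hc : 0 < 1 + (α - 1) * p := by nlinarith [mul_nonneg (sub_nonneg.2 hα) hp]
  have e1 : (1 + (α - 1) * p) * (1 - α * p / (1 + (α - 1) * p)) = 1 - p := by
    field_simp
    ring
  have e2 : (1 + (α - 1) * p) * (α * p / (1 + (α - 1) * p)) = p * α := by
    field_simp
  rw [averageKernel_apply, averageKernel_apply, smul_add, smul_smul, smul_smul,
    ← ENNReal.ofReal_mul hc.le, ← ENNReal.ofReal_mul hc.le, e1, e2, ENNReal.ofReal_mul hp]
  refine add_le_add le_rfl ?_
  rw [← smul_smul]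
  intro s
  simp only [Measure.smul_apply, smul_eq_mul]
  gcongr
  simpa using h s

theorem condEntropy_le_add_mul {𝓧 Ω S ι : Type*} [MeasurableSpace 𝓧] [MeasurableSpace Ω]
    [MeasurableSpace S] [MeasurableSpace ι] [Countable ι] [DiscreteMeasurableSpace ι] [Nonempty ι]
    (W : Kernel 𝓧 Ω) [IsMarkovKernel W] (Q : Measure Ω) [IsProbabilityMeasure Q] {α p : ℝ}
    (hα : 1 ≤ α) (hp : 0 < p) (hp1 : p < 1) (hW : ∀ x, W x ≤ ENNReal.ofReal α • Q) {n : ℕ}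
    {P : Measure S} [IsProbabilityMeasure P] {I : S → ι} {Z : S → Fin n → Ω} {X : S → Fin n → 𝓧}
    {Y : S → Fin n → Ω} (hI : Measurable I) (hZ : Measurable Z) (hX : Measurable X)
    (hY : Measurable Y) (hM : IsMarkovQuadruple P I Z X Y)
    (hYX : HasCondLaw P Y X (memoryless W n)) (hZX : HasCondLaw P Z X (memoryless W n)) :
    condEntropy P I Y ≤ ENNReal.ofReal (n * Real.log (1 + (α - 1) * p)) +
      ENNReal.ofReal (1 / p) * condEntropy P I X := by
  obtain ⟨⟨κ, _, hκ⟩, hZXY⟩ := hM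
  have hap : 0 ≤ (α - 1) * p := mul_nonneg (sub_nonneg.2 hα) hp.le
  set c := 1 + (α - 1) * p with hc
  have hc1 : 1 ≤ c := by linarith
  have hs0 : 0 ≤ α * p / c := by positivity
  have hs1 : α * p / c ≤ 1 := by
    rw [div_le_one (by linarith), hc]
    linarith
  have := isMarkovKernel_averageKernel hs0 hs1 Q
  -- The guess of `I`: perturb `y` by the `Q`-averaging kernel in each coordinate, then treat the
  -- result as an observation of `Z`.
  refine condEntropy_le_of_lintegral_negLog_le hI hZ hX hY hκ hZXY hZX hYX
    (η := κ ∘ₖ memoryless (averageKernel (α * p / c) Q) n) fun x i => ?_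
  have : ∀ j, IsMarkovKernel (averageKernel p (W (x j))) := fun j =>
    isMarkovKernel_averageKernel hp.le hp1.le (W (x j))
  have hf : Measurable fun z => κ z {i} := κ.measurable_coe (measurableSet_singleton i)
  have hrhc := IsReverseHypercontractive.pi hp hp1 (fun j => averageKernel p (W (x j)))
    (fun j => W (x j)) (fun j => isReverseHypercontractive_averageKernel hp hp1 (W (x j)))
    (fun z => κ z {i}) hf fun z => prob_le_one
  set T := productKernel fun j => averageKernel p (W (x j)) with hT
  have hdom : ∀ y, ∫⁻ z, κ z {i} ∂T y ≤ ENNReal.ofReal (c ^ n) *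
      (κ ∘ₖ memoryless (averageKernel (α * p / c) Q) n) y {i} := fun y => by
    rw [ENNReal.ofReal_pow (by linarith), Kernel.comp_apply' _ _ _ (measurableSet_singleton i)]
    exact lintegral_pi_le_of_le_smul _ _
      (fun j => averageKernel_le_smul hα hp.le (hW (x j)) (y j)) hf
  calc _ ≤ ∫⁻ y, (ENNReal.ofReal (n * Real.log c) + negLog (∫⁻ z, κ z {i} ∂T y))
          ∂memoryless W n x := by
        refine lintegral_mono fun y => ?_
        rw [← Real.log_pow]
        exact negLog_le_add (one_le_pow₀ hc1) (hdom y)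
    _ = ENNReal.ofReal (n * Real.log c) + ∫⁻ y, negLog (∫⁻ z, κ z {i} ∂T y) ∂memoryless W n x := by
        rw [lintegral_add_left measurable_const]
        simp
    _ ≤ ENNReal.ofReal (n * Real.log c) +
          ENNReal.ofReal (1 / p) * negLog (∫⁻ z, κ z {i} ^ p ∂memoryless W n x) := by
        gcongr
        exact hrhc
    _ ≤ _ := by
        gcongr
        -- A probability does not decrease when raised to a power `p < 1`.
        refine negLog_anti ?_
        rw [Kernel.comp_apply' _ _ _ (measurableSet_singleton i)]
        refine lintegral_mono fun z => ?_
        simpa using ENNReal.rpow_le_rpow_of_exponent_ge (prob_le_one (μ := κ z) (s := {i})) hp1.le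

/-- The entropy bound `H(I|Yⁿ) / n ≤ c_α(H(I|Xⁿ) / n)`. -/
theorem condEntropy_le_cBound {𝓧 Ω S ι : Type*} [MeasurableSpace 𝓧] [MeasurableSpace Ω]
    [MeasurableSpace S] [MeasurableSpace ι] [Countable ι] [DiscreteMeasurableSpace ι] [Nonempty ι]
    (W : Kernel 𝓧 Ω) [IsMarkovKernel W] (Q : Measure Ω) [IsProbabilityMeasure Q] {α : ℝ}
    (hα : 1 ≤ α) (hW : ∀ x, W x ≤ ENNReal.ofReal α • Q) {n : ℕ} (hn : 0 < n)
    {P : Measure S} [IsProbabilityMeasure P] {I : S → ι} {Z : S → Fin n → Ω} {X : S → Fin n → 𝓧}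
    {Y : S → Fin n → Ω} (hI : Measurable I) (hZ : Measurable Z) (hX : Measurable X)
    (hY : Measurable Y) (hM : IsMarkovQuadruple P I Z X Y)
    (hYX : HasCondLaw P Y X (memoryless W n)) (hZX : HasCondLaw P Z X (memoryless W n))
    (hfin : condEntropy P I X < ∞) :
    condEntropy P I Y < ∞ ∧ (1 / (n : ℝ)) * (condEntropy P I Y).toReal ≤
      cBound α ((1 / (n : ℝ)) * (condEntropy P I X).toReal) := by
  have key : ∀ t : ℝ, 0 < t → condEntropy P I Y ≤
      ENNReal.ofReal (n * Real.log (1 + (α - 1) * (1 - Real.exp (-t)))) +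
        ENNReal.ofReal (1 / (1 - Real.exp (-t))) * condEntropy P I X := fun t ht =>
    condEntropy_le_add_mul W Q hα (by simpa using ht) (by linarith [Real.exp_pos (-t)]) hW
      hI hZ hX hY hM hYX hZX
  have hrhs : ∀ t : ℝ, ENNReal.ofReal (n * Real.log (1 + (α - 1) * (1 - Real.exp (-t)))) +
        ENNReal.ofReal (1 / (1 - Real.exp (-t))) * condEntropy P I X ≠ ∞ := fun t =>
    ENNReal.add_ne_top.2 ⟨ENNReal.ofReal_ne_top, ENNReal.mul_ne_top ENNReal.ofReal_ne_top hfin.ne⟩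
  refine ⟨(key 1 one_pos).trans_lt (hrhs 1).lt_top, ?_⟩
  refine le_csInf (nonempty_Ioi.image _) ?_
  rintro _ ⟨t, ht, rfl⟩
  have ht : 0 < t := ht
  have hp : 0 < 1 - Real.exp (-t) := by simpa using ht
  have hap : 0 ≤ (α - 1) * (1 - Real.exp (-t)) := mul_nonneg (sub_nonneg.2 hα) hp.le
  have hn' : (0 : ℝ) < n := by exact_mod_cast hn
  have h := ENNReal.toReal_mono (hrhs t) (key t ht)
  rw [ENNReal.toReal_add ENNReal.ofReal_ne_top (ENNReal.mul_ne_top ENNReal.ofReal_ne_top hfin.ne),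
    ENNReal.toReal_mul, ENNReal.toReal_ofReal (mul_nonneg hn'.le (Real.log_nonneg (by linarith))),
    ENNReal.toReal_ofReal (one_div_nonneg.2 hp.le)] at h
  -- `ln (1 + x) ≤ x` and `1 - e^{-t} ≤ t`.
  have hlog : Real.log (1 + (α - 1) * (1 - Real.exp (-t))) ≤ (α - 1) * t := by
    have h1 := Real.log_le_sub_one_of_pos (by linarith : 0 < 1 + (α - 1) * (1 - Real.exp (-t)))
    have h2 : 1 - Real.exp (-t) ≤ t := by linarith [Real.add_one_le_exp (-t)]
    nlinarith [mul_le_mul_of_nonneg_left h2 (sub_nonneg.2 hα)]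
  calc (1 / (n : ℝ)) * (condEntropy P I Y).toReal
      ≤ (1 / (n : ℝ)) * (n * Real.log (1 + (α - 1) * (1 - Real.exp (-t))) +
          1 / (1 - Real.exp (-t)) * (condEntropy P I X).toReal) := by gcongr
    _ = Real.log (1 + (α - 1) * (1 - Real.exp (-t))) +
          1 / (1 - Real.exp (-t)) * ((1 / (n : ℝ)) * (condEntropy P I X).toReal) := by
        field_simp
    _ ≤ _ := add_le_add hlog le_rfl

/-! ### The function `c_α(h)` and its closed form -/

lemma cBound_one {h : ℝ} (hh : 0 ≤ h) : cBound 1 h = h := by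
  refine csInf_eq_of_forall_ge_of_forall_gt_exists_lt (nonempty_Ioi.image _) ?_ ?_
  · rintro _ ⟨t, ht, rfl⟩
    have hp : 0 < 1 - Real.exp (-t) := by simpa using ht
    have : 1 ≤ 1 / (1 - Real.exp (-t)) := by
      rw [le_div_iff₀ hp]
      linarith [Real.exp_pos (-t)]
    simp only [sub_self, zero_mul, zero_add]
    nlinarith
  · intro w hw
    have hw0 : 0 < w := hh.trans_lt hw
    have hr : h / w < 1 := (div_lt_one hw0).2 hw
    have hr0 : 0 ≤ h / w := by positivity
    have hδ : 0 < (1 - h / w) / 2 := by linarith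
    -- With this `t`, `1 - e^{-t} = (1 + h / w) / 2 > h / w`, so the value falls below `w`.
    refine ⟨_, ⟨-Real.log ((1 - h / w) / 2), ?_, rfl⟩, ?_⟩
    · simpa using Real.log_neg hδ (by linarith)
    · simp only [sub_self, zero_mul, zero_add, neg_neg, Real.exp_log hδ]
      rw [one_div_mul_eq_div, div_lt_iff₀ (by linarith)]
      have : w * (h / w) = h := by field_simp
      nlinarith

lemma cBound_zero_right {α : ℝ} (hα : 1 < α) : cBound α 0 = 0 := by
  have ha : 0 < α - 1 := sub_pos.2 hα
  refine csInf_eq_of_forall_ge_of_forall_gt_exists_lt (nonempty_Ioi.image _) ?_ ?_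
  · rintro _ ⟨t, ht, rfl⟩
    have ht : 0 < t := ht
    simp only [mul_zero, add_zero]
    positivity
  · intro w hw
    refine ⟨_, ⟨w / (2 * (α - 1)), div_pos hw (by linarith), rfl⟩, ?_⟩
    simp only [mul_zero, add_zero]
    have : (α - 1) * (w / (2 * (α - 1))) = w / 2 := by field_simp
    linarith

lemma one_div_one_sub_exp_neg {t : ℝ} :
    1 / (1 - Real.exp (-t)) = Real.exp t / (Real.exp t - 1) := by
  have h := Real.exp_pos t
  rw [Real.exp_neg, show 1 - (Real.exp t)⁻¹ = (Real.exp t - 1) / Real.exp t by field_simp,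
    one_div_div]

/-- The minimum of `(α - 1) t + h / (1 - e^{-t})` is attained at `e^t = 1 + w`, where `w` is the
positive root of `(α - 1) w² = h (1 + w)`. -/
lemma isLeast_boundValues {α h w : ℝ} (hα : 1 < α) (hw : 0 < w)
    (e : (α - 1) * w ^ 2 = h * (1 + w)) :
    IsLeast (boundValues α h) ((α - 1) * (Real.log (1 + w) + w)) := by
  have ha : 0 < α - 1 := sub_pos.2 hα
  have hh : h = (α - 1) * w ^ 2 / (1 + w) := by
    field_simp
    linarith
  constructor
  · refine ⟨Real.log (1 + w), Real.log_pos (by linarith), ?_⟩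
    simp only [one_div_one_sub_exp_neg]
    rw [Real.exp_log (by linarith), hh]
    have : 1 + w - 1 = w := by ring
    rw [this]
    field_simp
  · rintro _ ⟨t, ht, rfl⟩
    have ht : 0 < t := ht
    simp only [one_div_one_sub_exp_neg]
    obtain ⟨v, hv⟩ : ∃ v, v = Real.exp t - 1 := ⟨_, rfl⟩
    have hv0 : 0 < v := by
      rw [hv]
      linarith [Real.add_one_le_exp t]
    have hev : Real.exp t = 1 + v := by linarith
    have htv : t = Real.log (1 + v) := by rw [← hev, Real.log_exp]
    -- The bound `ln r ≥ 1 - 1 / r` at `r = (1 + v) / (1 + w)` is tight at `v = w`; the remaining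
    -- rational expression is a perfect square over a positive denominator.
    have hl := Real.one_sub_inv_le_log_of_pos (by positivity : 0 < (1 + v) / (1 + w))
    rw [Real.log_div (by positivity) (by positivity), inv_div] at hl
    have hsq : 1 - (1 + w) / (1 + v) + (1 + v) / v * (w ^ 2 / (1 + w)) - w =
        (v - w) ^ 2 / ((1 + v) * (v * (1 + w))) := by
      field_simp
      ring
    have hsq0 : 0 ≤ (v - w) ^ 2 / ((1 + v) * (v * (1 + w))) := by positivity
    have hmain : Real.log (1 + w) + w ≤ Real.log (1 + v) + (1 + v) / v * (w ^ 2 / (1 + w)) := by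
      linarith
    rw [hev, htv, hh, add_sub_cancel_left]
    calc _ ≤ _ := mul_le_mul_of_nonneg_left hmain ha.le
      _ = _ := by ring

lemma isLeast_boundValues_cClosed {α h : ℝ} (hα : 1 < α) (hh : 0 < h) :
    IsLeast (boundValues α h) (cClosed α h) := by
  have ha : 0 < α - 1 := sub_pos.2 hα
  have hs : √(h / (α - 1) + h ^ 2 / (4 * (α - 1) ^ 2)) ^ 2 =
      h / (α - 1) + h ^ 2 / (4 * (α - 1) ^ 2) := Real.sq_sqrt (by positivity)
  -- The positive root of `(α - 1) w² - h w - h = 0`.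
  have := isLeast_boundValues (w := h / (2 * (α - 1)) +
    √(h / (α - 1) + h ^ 2 / (4 * (α - 1) ^ 2))) hα (by positivity) (h := h) (by
      set r := √(h / (α - 1) + h ^ 2 / (4 * (α - 1) ^ 2))
      rw [add_sq, hs]
      field_simp
      ring)
  rwa [← add_assoc, ← add_assoc] at this

theorem cBound_eq_cClosed {α h : ℝ} (hα : 1 < α) (hh : 0 ≤ h) : cBound α h = cClosed α h := by
  rcases hh.eq_or_lt with rfl | hh
  · rw [cBound_zero_right hα]
    simp [cClosed]
  · exact (isLeast_boundValues_cClosed hα hh).csInf_eq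

/-! ### Discrete output alphabets -/

lemma tsum_iSup_lt_top {𝓧 Ω : Type*} [MeasurableSpace 𝓧] [MeasurableSpace Ω] [Countable Ω]
    [DiscreteMeasurableSpace Ω] (W : Kernel 𝓧 Ω) [IsMarkovKernel W] (h : Finite 𝓧 ∨ Finite Ω) :
    ∑' y : Ω, ⨆ x : 𝓧, W x {y} < ∞ := by
  rcases h with h | h
  · have := Fintype.ofFinite 𝓧
    calc ∑' y : Ω, ⨆ x : 𝓧, W x {y} ≤ ∑' y : Ω, ∑ x : 𝓧, W x {y} := by
          refine ENNReal.tsum_le_tsum fun y => iSup_le fun x => ?_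
          exact Finset.single_le_sum (f := fun x => W x {y}) (fun _ _ => zero_le)
            (Finset.mem_univ x)
      _ = ∑ x : 𝓧, ∑' y : Ω, W x {y} := Summable.tsum_finsetSum fun _ _ => ENNReal.summable
      _ = Fintype.card 𝓧 := by simp [tsum_measure_singleton]
      _ < ∞ := ENNReal.natCast_lt_top _
  · have := Fintype.ofFinite Ω
    calc ∑' y : Ω, ⨆ x : 𝓧, W x {y} ≤ ∑' _ : Ω, 1 :=
          ENNReal.tsum_le_tsum fun y => iSup_le fun x => prob_le_one
      _ < ∞ := by simp

/-- A discrete output distribution whose density bound is `∑ y, sup_x W_x(y)`. -/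
lemma exists_densityBound_eq {𝓧 Ω : Type*} [MeasurableSpace 𝓧] [MeasurableSpace Ω] [Nonempty 𝓧]
    [Countable Ω] [DiscreteMeasurableSpace Ω] (W : Kernel 𝓧 Ω) [IsMarkovKernel W]
    (h : ∑' y : Ω, ⨆ x : 𝓧, W x {y} < ∞) :
    ∃ Q : Measure Ω, IsProbabilityMeasure Q ∧ (∀ x, W x ≪ Q) ∧
      densityBound W Q = ∑' y : Ω, ⨆ x : 𝓧, W x {y} := by
  set s : Ω → ℝ≥0∞ := fun y => ⨆ x : 𝓧, W x {y} with hs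
  set M := ∑' y, s y with hM
  have hM0 : M ≠ 0 := by
    obtain ⟨x⟩ := ‹Nonempty 𝓧›
    have : 1 ≤ M := by
      calc (1 : ℝ≥0∞) = ∑' y, W x {y} := by rw [tsum_measure_singleton, measure_univ]
        _ ≤ M := ENNReal.tsum_le_tsum fun y => le_iSup (fun x => W x {y}) x
    exact (one_pos.trans_le this).ne'
  have hsing : ∀ (f : Ω → ℝ≥0∞) y, (Measure.count.withDensity f) {y} = f y := fun f y => by
    rw [withDensity_apply _ (measurableSet_singleton y), lintegral_singleton]
    simp
  set Q : Measure Ω := M⁻¹ • Measure.count.withDensity s with hQ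
  have hMQ : M • Q = Measure.count.withDensity s := by
    rw [hQ, smul_smul, ENNReal.mul_inv_cancel hM0 h.ne, one_smul]
  have hQp : IsProbabilityMeasure Q := ⟨by
    rw [hQ, Measure.smul_apply, withDensity_apply _ MeasurableSet.univ, Measure.restrict_univ,
      lintegral_count, smul_eq_mul, ENNReal.inv_mul_cancel hM0 h.ne]⟩
  have hle : ∀ x, W x ≤ M • Q := fun x => by
    have e : W x = Measure.count.withDensity fun y => W x {y} :=
      Measure.ext_of_singleton fun y => (hsing (fun y => W x {y}) y).symm
    rw [hMQ, e]
    exact withDensity_mono (ae_of_all _ fun y => le_iSup (fun x => W x {y}) x)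
  have hac : ∀ x, W x ≪ Q := fun x =>
    (Measure.absolutelyContinuous_of_le (hle x)).trans Measure.smul_absolutelyContinuous
  refine ⟨Q, hQp, hac, le_antisymm (iSup_le fun x => essSup_rnDeriv_le_of_le_smul (hle x)) ?_⟩
  -- Any dominating constant must satisfy `sup_x W_x(y) ≤ c Q(y)` at each `y`; summing over `y`
  -- shows that none is smaller than `M`.
  calc M ≤ ∑' y, densityBound W Q * Q {y} :=
        ENNReal.tsum_le_tsum fun y => iSup_le fun x => le_densityBound_smul W Q x (hac x) {y}
    _ = densityBound W Q := by
        rw [ENNReal.tsum_mul_left, tsum_measure_singleton, measure_univ, mul_one]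

end RelayChannel

theorem mainTheorem5 {𝓧 Ω : Type*} [MeasurableSpace 𝓧] [MeasurableSpace Ω] [Nonempty 𝓧]
    (W : Kernel 𝓧 Ω) [IsMarkovKernel W] :
    -- the entropy bound
    (∀ (Q : Measure Ω) [IsProbabilityMeasure Q], (∀ x, W x ≪ Q) →
      RelayChannel.densityBound W Q < ∞ →
      1 ≤ (RelayChannel.densityBound W Q).toReal ∧
      ∀ (n : ℕ), 0 < n →
      ∀ {S ι : Type*} [MeasurableSpace S] [MeasurableSpace ι] [Countable ι]
        [DiscreteMeasurableSpace ι] [Nonempty ι] (P : Measure S) [IsProbabilityMeasure P]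
        (I : S → ι) (Z : S → Fin n → Ω) (X : S → Fin n → 𝓧) (Y : S → Fin n → Ω),
        Measurable I → Measurable Z → Measurable X → Measurable Y →
        RelayChannel.IsMarkovQuadruple P I Z X Y →
        RelayChannel.HasCondLaw P Y X (RelayChannel.memoryless W n) →
        RelayChannel.HasCondLaw P Z X (RelayChannel.memoryless W n) →
        RelayChannel.condEntropy P I X < ∞ →
        RelayChannel.condEntropy P I Y < ∞ ∧
        (1 / (n : ℝ)) * (RelayChannel.condEntropy P I Y).toReal ≤
          RelayChannel.cBound (RelayChannel.densityBound W Q).toReal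
            ((1 / (n : ℝ)) * (RelayChannel.condEntropy P I X).toReal)) ∧
    -- the minimum and its closed form, with the boundary cases
    (∀ α h : ℝ, 1 < α → 0 ≤ h →
      (0 < h → IsLeast (RelayChannel.boundValues α h) (RelayChannel.cBound α h)) ∧
      RelayChannel.cBound α h = RelayChannel.cClosed α h) ∧
    (∀ h : ℝ, 0 ≤ h → RelayChannel.cBound 1 h = h) ∧
    -- the discrete case
    (∀ [Countable Ω] [DiscreteMeasurableSpace Ω],
      ((Finite 𝓧 ∨ Finite Ω) → (∑' y : Ω, ⨆ x : 𝓧, W x {y}) < ∞) ∧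
      ((∑' y : Ω, ⨆ x : 𝓧, W x {y}) < ∞ →
        ∃ Q : Measure Ω, IsProbabilityMeasure Q ∧ (∀ x, W x ≪ Q) ∧
          RelayChannel.densityBound W Q = ∑' y : Ω, ⨆ x : 𝓧, W x {y})) := by
  refine ⟨fun Q _ hQ hfin => ?_, fun α h hα hh => ⟨fun h0 => ?_,
    RelayChannel.cBound_eq_cClosed hα hh⟩, fun h => RelayChannel.cBound_one, ?_⟩
  · have h1 := RelayChannel.one_le_densityBound W Q hQ
    have hα : 1 ≤ (RelayChannel.densityBound W Q).toReal := by
      simpa using ENNReal.toReal_mono hfin.ne h1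
    refine ⟨hα, fun n hn S ι _ _ _ _ _ P _ I Z X Y hI hZ hX hY hM hYX hZX hHX =>
      RelayChannel.condEntropy_le_cBound W Q hα (fun x => ?_) hn hI hZ hX hY hM hYX hZX hHX⟩
    rw [ENNReal.ofReal_toReal hfin.ne]
    exact RelayChannel.le_densityBound_smul W Q x (hQ x)
  · rw [RelayChannel.cBound_eq_cClosed hα hh]
    exact RelayChannel.isLeast_boundValues_cClosed hα h0
  · intro _ _
    exact ⟨RelayChannel.tsum_iSup_lt_top W, RelayChannel.exists_densityBound_eq W⟩
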